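/- For integers $0\le m\le l\le n$ let $\mathcal B_n(m,l)$ be the poset of all subsets of $[n]=\{1,\dots,n\}$ of size at least $m$ and at most $l$, ordered by inclusion. A \emph{cutset} in $\mathcal B_n(m,l)$ is a collection $\mathcal C\subseteq\mathcal B_n(m,l)$ that meets every chain of size $l-m+1$ in $\mathcal B_n(m,l)$; the \emph{width} of $\mathcal C$ is the size of the largest antichain contained in $\mathcal C$. Let $h_n(m,l)$ be the minimum width of a cutset in $\mathcal B_n(m,l)$, and let $g_n(m,l)$ be the smallest $k$ for which there is a cutset in $\mathcal B_n(m,l)$ with at most $k$ members of each size. Put $\Delta_n(k)=\binom nk-\binom n{k-1}$, where $\binom nk=0$ for $k<0$. Let $m$ and $n$ be non-negative integers. Then 1. $g_n(m,m)=h_n(m,m)=\sum_{j\ge0}\Delta_n(m-j)=\binom nm$ for $n\ge m$; 2. $g_n(m,m+1)=h_n(m,m+1)=\sum_{j\ge0}\Delta_n(m-2j)=\binom{n-1}m$ for $n\ge m+1$; 3. $g_n(m,m+2)=h_n(m,m+2)=\sum_{j\ge0}\Delta_n(m-3j)=\sum_{j=0}^m\binom{n-2j-2}{m-j}$ for $n\ge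 2m+2$. -/

import Mathlib

namespace TruncatedBoolean

/-- The truncated Boolean lattice `B_n(m,l)`: all subsets of an `n`-element set whose size is at
least `m` and at most `l`, ordered by inclusion. -/
def lattice (n m l : ℕ) : Finset (Finset (Fin n)) :=
  Finset.univ.filter fun A => m ≤ A.card ∧ A.card ≤ l

/-- A maximal chain of `B_n(m,l)`: a chain of size `l - m + 1`, that is, of length `l - m`.
As `B_n(m,l)` has only `l - m + 1` levels, it meets every level, and so it is saturated. -/
def IsMaximalChain (n m l : ℕ) (D : Finset (Finset (Fin n))) : Prop :=
  D ⊆ lattice n m l ∧ IsChain (· ⊆ ·) (D : Set (Finset (Fin n))) ∧ D.card = l - m + 1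

/-- A cutset of `B_n(m,l)`: a collection of nodes which intersects all maximal chains. -/
def IsCutset (n m l : ℕ) (C : Finset (Finset (Fin n))) : Prop :=
  C ⊆ lattice n m l ∧ ∀ D, IsMaximalChain n m l D → ∃ A ∈ D, A ∈ C

open Classical in
/-- The width of a collection of sets: the size of the largest antichain contained in it. -/
noncomputable def width {n : ℕ} (C : Finset (Finset (Fin n))) : ℕ :=
  (C.powerset.filter fun A : Finset (Finset (Fin n)) =>
    IsAntichain (· ⊆ ·) (A : Set (Finset (Fin n)))).sup Finset.card

/-- `h_n(m,l)`: the minimum width of a cutset in `B_n(m,l)`. -/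
noncomputable def h (n m l : ℕ) : ℕ :=
  sInf {w | ∃ C, IsCutset n m l C ∧ width C = w}

/-- `g_n(m,l)`: the smallest `k` for which there is a cutset in `B_n(m,l)` with at most `k` nodes
at each level. -/
noncomputable def g (n m l : ℕ) : ℕ :=
  sInf {k | ∃ C, IsCutset n m l C ∧ ∀ i, (C.slice i).card ≤ k}

/-- The binomial coefficient with an integer lower entry, which is zero if that entry is
negative. -/
def binom (n : ℕ) (k : ℤ) : ℤ := if 0 ≤ k then (n.choose k.toNat : ℤ) else 0

/-- `Δ_n(k) = C(n,k) - C(n,k-1)`. -/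
def delta (n : ℕ) (k : ℤ) : ℤ := binom n k - binom n (k - 1)

/-- `Δ_n(m) + Δ_n(m-c) + Δ_n(m-2c) + ...` for `c ≥ 1`. The terms with `j > m` are left out:
they vanish since `m - j c < 0`. -/
def deltaSum (n m c : ℕ) : ℤ := ∑ j ∈ Finset.range (m + 1), delta n ((m : ℤ) - j * c)

/-- The whole of `B_n(m,l)` is a cutset. -/
theorem isCutset_lattice (n m l : ℕ) : IsCutset n m l (lattice n m l) := by
  refine ⟨Finset.Subset.refl _, fun D hD => ?_⟩
  have hpos : 0 < D.card := by rw [hD.2.2]; omega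
  obtain ⟨A, hA⟩ := Finset.card_pos.1 hpos
  exact ⟨A, hA, hD.1 hA⟩

/-- The width is the size of a largest antichain. -/
theorem width_isGreatest {n : ℕ} (C : Finset (Finset (Fin n))) :
    IsGreatest {k | ∃ A ⊆ C, IsAntichain (· ⊆ ·) (A : Set (Finset (Fin n))) ∧ A.card = k}
      (width C) := by
  classical
  constructor
  · obtain ⟨A, hA, hAk⟩ := Finset.exists_mem_eq_sup
      (C.powerset.filter fun A : Finset (Finset (Fin n)) =>
        IsAntichain (· ⊆ ·) (A : Set (Finset (Fin n))))
      ⟨∅, by simp⟩ Finset.card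
    rw [Finset.mem_filter, Finset.mem_powerset] at hA
    refine ⟨A, hA.1, hA.2, ?_⟩
    rw [← hAk, width]
  · rintro k ⟨A, hAC, hA, rfl⟩
    exact Finset.le_sup (f := Finset.card)
      (Finset.mem_filter.2 ⟨Finset.mem_powerset.2 hAC, hA⟩)

/-- The minimum that defines `h` is attained. -/
theorem h_isLeast (n m l : ℕ) :
    IsLeast {w | ∃ C, IsCutset n m l C ∧ width C = w} (h n m l) :=
  ⟨Nat.sInf_mem ⟨_, _, isCutset_lattice n m l, rfl⟩, fun _ hw => Nat.sInf_le hw⟩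

/-- The minimum that defines `g` is attained. -/
theorem g_isLeast (n m l : ℕ) :
    IsLeast {k | ∃ C, IsCutset n m l C ∧ ∀ i, (C.slice i).card ≤ k} (g n m l) :=
  ⟨Nat.sInf_mem ⟨(lattice n m l).card, _, isCutset_lattice n m l,
    fun _ => Finset.card_le_card (Finset.filter_subset _ _)⟩, fun _ hk => Nat.sInf_le hk⟩

end TruncatedBoolean

/-! Each level of a cutset is an antichain, so `g ≤ h`. It suffices to exhibit a cutset of width at
most `w` and to show that no cutset has fewer than `w` members on every level.

Lower bound: suppose every level of `C` has at most `k < w` members, and let `F` be the `m`-sets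
outside `C`. For two levels the upper shadow of `F` lies in `C`; for three levels the part of it
outside `C` has its own upper shadow in `C`. Kruskal-Katona, applied to complements, bounds these
shadows below by those of explicit colex segments (`HasInitSeg`), and Pascal's rule shows that the
last shadow has more than `k` members.

Upper bound: for two levels use the pairs `A ⊂ A ∪ {a}` with `a` fixed. For three levels fix `a`,
`b` and use the chains `A ⊂ A ∪ {a} ⊂ A ∪ {a, b}`; the maximal chains that these miss consist of
sets containing `b` but not `a`, where `exists_thin_cutset` recurses on a ground set with two fewer
elements. -/

namespace TruncatedBoolean

open Finset Finset.Colex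
open scoped FinsetFamily

/-! ### Sizes of colex initial segments and of their shadows -/

/-- Splitting the initial segment of `insert x s`, where `x` exceeds all of `s`, by whether a
member contains `x`. -/
theorem card_initSeg_insert {n : ℕ} (x : Fin n) (s : Finset (Fin n)) (hs : ∀ y ∈ s, y < x) :
    #(initSeg (insert x s)) = #(initSeg s) + (x : ℕ).choose (#s + 1) := by
  have hxs : x ∉ s := fun h => lt_irrefl _ (hs x h)
  have hsplit : initSeg (insert x s)
      = (initSeg s).image (insert x) ∪ powersetCard (#s + 1) (Iio x) := by
    ext t
    simp only [mem_union, mem_image, mem_powersetCard, mem_initSeg, card_insert_of_notMem hxs]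
    constructor
    · rintro ⟨hc, hle⟩
      by_cases hxt : x ∈ t
      · left
        refine ⟨t.erase x, ⟨?_, ?_⟩, insert_erase hxt⟩
        · rw [card_erase_of_mem hxt]; omega
        · have := (toColex_sdiff_le_toColex_sdiff (singleton_subset_iff.2 hxt)
            (singleton_subset_iff.2 (mem_insert_self x s))).2 hle
          rwa [sdiff_singleton_eq_erase, sdiff_singleton_eq_erase, erase_insert hxs] at this
      · right
        refine ⟨fun y hy => ?_, hc.symm⟩
        have hyx : y ≤ x := forall_le_mono hle (by
          intro b hb
          rcases mem_insert.1 hb with rfl | hb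
          · exact le_rfl
          · exact (hs b hb).le) y hy
        exact mem_Iio.2 (lt_of_le_of_ne hyx fun h => hxt (h ▸ hy))
    · rintro (⟨u, ⟨hc, hle⟩, rfl⟩ | ⟨hsub, hc⟩)
      · have hxu : x ∉ u := fun h => lt_irrefl _ (forall_lt_mono hle hs x h)
        refine ⟨by rw [card_insert_of_notMem hxu, hc], ?_⟩
        refine (toColex_sdiff_le_toColex_sdiff (singleton_subset_iff.2 (mem_insert_self x u))
          (singleton_subset_iff.2 (mem_insert_self x s))).1 ?_
        rwa [sdiff_singleton_eq_erase, sdiff_singleton_eq_erase, erase_insert hxs,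
          erase_insert hxu]
      · refine ⟨hc.symm, ?_⟩
        have h1 : toColex t < toColex {x} :=
          toColex_lt_singleton.2 fun y hy => mem_Iio.1 (hsub hy)
        exact h1.le.trans (toColex_le_toColex_of_subset (by simp))
  have hnot : ∀ u ∈ initSeg s, x ∉ u := fun u hu h =>
    lt_irrefl _ (forall_lt_mono (mem_initSeg.1 hu).2 hs x h)
  rw [hsplit, card_union_of_disjoint, card_image_of_injOn, card_powersetCard, Fin.card_Iio]
  · intro u hu v hv huv
    have := congrArg (fun w => w.erase x) huv
    simpa [erase_insert (hnot u hu), erase_insert (hnot v hv)] using this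
  · rw [disjoint_left]
    rintro _ ht ht'
    obtain ⟨u, -, rfl⟩ := mem_image.1 ht
    exact lt_irrefl x (mem_Iio.1 ((mem_powersetCard.1 ht').1 (mem_insert_self x u)))

theorem card_initSeg_empty {n : ℕ} : #(initSeg (∅ : Finset (Fin n))) = 1 := by
  rw [card_eq_one]
  refine ⟨∅, ?_⟩
  ext t
  simp only [mem_initSeg, card_empty, mem_singleton]
  constructor
  · rintro ⟨h, -⟩
    exact card_eq_zero.1 h.symm
  · rintro rfl
    simp

/-- There is an initial segment of the colex order on the `r`-subsets of `{0, …, k - 1}` that has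
`s` members and a shadow with `t` members. -/
def HasInitSeg (n r k s t : ℕ) : Prop :=
  ∃ (U : Finset (Fin n)) (hU : U.Nonempty), #U = r ∧ (∀ x ∈ U, (x : ℕ) < k) ∧
    #(initSeg U) = s ∧ #(initSeg (U.erase (U.min' hU))) = t

/-- Adjoining a new maximum `x` to the last member `U` places all `(r + 1)`-subsets of `{0, …, x -
1}` before the sets containing `x`. The minimum of `U` is unchanged, so the shadow grows in the same
way, by the `r`-subsets. -/
theorem HasInitSeg.extend {n r k s t : ℕ} (h : HasInitSeg n r k s t) {x : ℕ} (hkx : k ≤ x)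
    (hxn : x < n) : HasInitSeg n (r + 1) (x + 1) (s + x.choose (r + 1)) (t + x.choose r) := by
  obtain ⟨U, hU, hr, hk, rfl, rfl⟩ := h
  set X : Fin n := ⟨x, hxn⟩ with hX
  have hlt : ∀ y ∈ U, y < X := fun y hy => Fin.lt_def.2 ((hk y hy).trans_le hkx)
  have hXU : X ∉ U := fun h => lt_irrefl _ (hlt X h)
  have hmin : (insert X U).min' (insert_nonempty X U) = U.min' hU := by
    rw [min'_insert X U hU]
    exact min_eq_right (hlt _ (min'_mem U hU)).le
  have hne : X ≠ U.min' hU := (hlt _ (min'_mem U hU)).ne'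
  refine ⟨insert X U, insert_nonempty X U, ?_, ?_, ?_, ?_⟩
  · rw [card_insert_of_notMem hXU, hr]
  · intro y hy
    rcases mem_insert.1 hy with rfl | hy
    · exact Nat.lt_succ_self x
    · exact (hk y hy).trans_le (hkx.trans (Nat.le_succ x))
  · rw [card_initSeg_insert X U hlt, hr]
  · have hpos : 0 < #U := hU.card_pos
    rw [hmin, erase_insert_of_ne hne,
      card_initSeg_insert X _ fun y hy => hlt y (mem_of_mem_erase hy),
      card_erase_of_mem (min'_mem U hU), Nat.sub_add_cancel hpos, hr]

theorem hasInitSeg_singleton {n x : ℕ} (hx : x < n) : HasInitSeg n 1 (x + 1) (x + 1) 1 := by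
  refine ⟨{⟨x, hx⟩}, singleton_nonempty _, by simp, by simp, ?_, ?_⟩
  · have := card_initSeg_insert (⟨x, hx⟩ : Fin n) ∅ (by simp)
    rw [card_initSeg_empty] at this
    simpa [add_comm] using this
  · simp [card_initSeg_empty]

/-- All `r`-subsets of `{0, …, k - 1}`. -/
theorem hasInitSeg_powersetCard {n : ℕ} (a d : ℕ) (h : a + d + 1 ≤ n) :
    HasInitSeg n (d + 1) (a + d + 1) ((a + d + 1).choose (d + 1)) ((a + d + 1).choose d) := by
  induction d with
  | zero => simpa using hasInitSeg_singleton (n := n) (x := a) (by omega)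
  | succ d ih =>
    have := (ih (by omega)).extend (x := a + d + 1) le_rfl (by omega)
    rw [← Nat.choose_succ_succ' (a + d + 1) (d + 1), ← Nat.choose_succ_succ' (a + d + 1) d] at this
    exact this

/-- The Kruskal-Katona theorem for upper shadows. -/
theorem HasInitSeg.le_card_upShadow {n m r k s t : ℕ} (h : HasInitSeg n r k s t)
    (hmr : m + r = n) {F : Finset (Finset (Fin n))} (hF : (F : Set (Finset (Fin n))).Sized m)
    (hs : s ≤ #F) : t ≤ #(∂⁺ F) := by
  obtain ⟨U, hU, rfl, -, rfl, rfl⟩ := h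
  -- Complementation turns the upper shadow into the shadow, and `m`-sets into `r`-sets.
  have hFc : ((Fᶜˢ : Finset (Finset (Fin n))) : Set (Finset (Fin n))).Sized #U := by
    intro A hA
    have := hF (mem_compls.1 (mem_coe.1 hA))
    rw [card_compl, Fintype.card_fin] at this
    have := card_le_univ A
    rw [Fintype.card_fin] at this
    have := hU.card_pos
    omega
  have := kruskal_katona hFc (by rwa [card_compls]) (isInitSeg_initSeg (s := U))
  rwa [shadow_compls, card_compls, shadow_initSeg hU] at this

/-- The elements adjoined are `x, x + 2, …, x + 2 * (m - 1)`. The bound on `k'` lets the induction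
adjoin the next one; the `max` covers `m = 0`. -/
theorem HasInitSeg.extend_iterate {n r k s t : ℕ} (h : HasInitSeg n r k s t) (m : ℕ) {x : ℕ}
    (hkx : k ≤ x) (hxn : x + 2 * m ≤ n + 1) : ∃ k', k' ≤ max k (x + 2 * m - 1) ∧
    HasInitSeg n (r + m) k' (s + ∑ i ∈ range m, (x + 2 * i).choose (r + i + 1))
      (t + ∑ i ∈ range m, (x + 2 * i).choose (r + i)) := by
  induction m with
  | zero => exact ⟨k, le_max_left _ _, by simpa using h⟩
  | succ m ih =>
    obtain ⟨k', hk', hm⟩ := ih (by omega)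
    refine ⟨x + 2 * m + 1, by omega, ?_⟩
    rw [sum_range_succ, sum_range_succ, ← add_assoc, ← add_assoc, ← add_assoc]
    exact hm.extend (by omega) (by omega)

/-! ### Lower bounds on the levels of a cutset -/

theorem IsCutset.mem_or_mem {n m : ℕ} {C : Finset (Finset (Fin n))} (hC : IsCutset n m (m + 1) C)
    {A B : Finset (Fin n)} (hA : #A = m) (hB : #B = m + 1) (hAB : A ⊆ B) : A ∈ C ∨ B ∈ C := by
  have hne : A ≠ B := fun h => by subst h; omega
  have hchain : IsMaximalChain n m (m + 1) {A, B} := by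
    refine ⟨?_, ?_, ?_⟩
    · simp [insert_subset_iff, lattice, hA, hB]
    · rw [coe_pair]
      exact IsChain.pair hAB
    · rw [card_pair hne, Nat.add_sub_cancel_left]
  obtain ⟨E, hE, hEC⟩ := hC.2 _ hchain
  simp only [mem_insert, mem_singleton] at hE
  rcases hE with rfl | rfl <;> simp [hEC]

theorem IsCutset.mem_or_mem_or_mem {n m : ℕ} {C : Finset (Finset (Fin n))}
    (hC : IsCutset n m (m + 2) C) {A B D : Finset (Fin n)} (hA : #A = m) (hB : #B = m + 1)
    (hD : #D = m + 2) (hAB : A ⊆ B) (hBD : B ⊆ D) : A ∈ C ∨ B ∈ C ∨ D ∈ C := by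
  have hne : A ≠ B := fun h => by subst h; omega
  have hne' : A ≠ D := fun h => by subst h; omega
  have hne'' : B ≠ D := fun h => by subst h; omega
  have hchain : IsMaximalChain n m (m + 2) {A, B, D} := by
    refine ⟨?_, ?_, ?_⟩
    · simp [insert_subset_iff, lattice, hA, hB, hD]
    · rw [coe_insert, coe_pair]
      refine (IsChain.pair hBD).insert fun E hE _ => Or.inl ?_
      rcases hE with rfl | rfl
      · exact hAB
      · exact hAB.trans hBD
    · rw [card_insert_of_notMem (by simp [hne, hne']), card_pair hne'', Nat.add_sub_cancel_left]
  obtain ⟨E, hE, hEC⟩ := hC.2 _ hchain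
  simp only [mem_insert, mem_singleton] at hE
  rcases hE with rfl | rfl | rfl <;> simp [hEC]

theorem card_le_card_powersetCard_sdiff {n m k : ℕ} {C : Finset (Finset (Fin n))}
    (hk : #(C.slice m) ≤ k) : n.choose m ≤ #(powersetCard m univ \ C) + k := by
  have h1 : #(powersetCard m (univ : Finset (Fin n))) = n.choose m := by simp
  have h2 : powersetCard m univ ∩ C ⊆ C.slice m := fun A hA => by
    rw [mem_inter, mem_powersetCard] at hA
    exact mem_slice.2 ⟨hA.2, hA.1.2⟩
  have h3 := card_sdiff_add_card_inter (powersetCard m (univ : Finset (Fin n))) C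
  have h4 := card_le_card h2
  omega

/-- A cutset of two levels has at least `C(n - 1, m)` members on one of them. -/
theorem IsCutset.choose_le_of_card_slice_le {m d k : ℕ} {C : Finset (Finset (Fin (m + d + 1)))}
    (hC : IsCutset (m + d + 1) m (m + 1) C) (hk : ∀ i, #(C.slice i) ≤ k) :
    (m + d).choose m ≤ k := by
  by_contra! hlt
  -- The segment ends at `{0, …, d - 1} ∪ {m + d}`, the first set containing the top element. For `d
  -- = 0` this is a singleton, which `extend` cannot reach from a nonempty set.
  have hinit : ∃ k' s t, HasInitSeg (m + d + 1) (d + 1) k' s t ∧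
      s ≤ 1 + (m + d).choose (d + 1) ∧ (m + d).choose d ≤ t := by
    cases d with
    | zero => exact ⟨_, _, _, hasInitSeg_singleton (x := m) (by omega), by simp [add_comm],
        by simp⟩
    | succ e =>
      have := (hasInitSeg_powersetCard (n := m + (e + 1) + 1) 0 e (by omega)).extend
        (x := m + (e + 1)) (by omega) (by omega)
      exact ⟨_, _, _, this, by simp, by omega⟩
  obtain ⟨k', s, t, hinit, hs, ht⟩ := hinit
  have hF : ((powersetCard m univ \ C : Finset (Finset (Fin (m + d + 1)))) :
      Set (Finset (Fin (m + d + 1)))).Sized m := fun A hA =>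
    (mem_powersetCard.1 (mem_sdiff.1 (mem_coe.1 hA)).1).2
  have h1 := card_le_card_powersetCard_sdiff (hk m)
  have hp : (m + d + 1).choose m = (m + d).choose (d + 1) + (m + d).choose m := by
    rw [Nat.choose_symm_of_eq_add (show m + d + 1 = m + (d + 1) by omega), Nat.choose_succ_succ',
      Nat.choose_symm_of_eq_add (rfl : m + d = m + d), add_comm]
  have h2 := hinit.le_card_upShadow (by omega) hF (by omega)
  have h3 : ∂⁺ (powersetCard m univ \ C) ⊆ C.slice (m + 1) := by
    intro B hB
    have hBc := hF.upShadow hB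
    obtain ⟨A, hA, hAB⟩ := exists_subset_of_mem_upShadow hB
    refine mem_slice.2 ⟨?_, hBc⟩
    exact (hC.mem_or_mem (hF hA) hBc hAB).resolve_left (mem_sdiff.1 hA).2
  have h4 := card_le_card h3
  have h5 := hk (m + 1)
  rw [Nat.choose_symm_of_eq_add (rfl : m + d = m + d)] at hlt
  omega

/-- The width of a thinnest cutset of the levels `m`, `m + 1`, `m + 2` of the subsets of a set
with `p + 2 * m + 2` elements. -/
def thinWidth (p m : ℕ) : ℕ := ∑ i ∈ range (m + 1), (p + 2 * i).choose i

theorem thinWidth_succ (p m : ℕ) :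
    thinWidth p (m + 1) = thinWidth p m + (p + 2 * m + 2).choose (m + 1) := by
  rw [thinWidth, sum_range_succ, thinWidth]
  rfl

/-- The first sum is the size of the segment compared with `F`. The extra 1 reflects that `k <
thinWidth p m` leaves at least `C(n, m) - thinWidth p m + 1` sets in `F`. -/
theorem sum_choose_add_thinWidth (p m : ℕ) :
    1 + ∑ i ∈ range m, (p + 3 + 2 * i).choose (p + 2 + i + 1) + thinWidth p m
      = (p + 2 * m + 2).choose m + 1 := by
  induction m with
  | zero => simp [thinWidth]
  | succ m ih =>
    rw [sum_range_succ, thinWidth_succ,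
      Nat.choose_symm_of_eq_add (show p + 3 + 2 * m = (p + 2 + m + 1) + m by omega)]
    have h1 := Nat.choose_succ_succ' (p + 2 * m + 2) m
    have h2 := Nat.choose_succ_succ' (p + 2 * m + 2 + 1) m
    rw [show p + 3 + 2 * m = p + 2 * m + 2 + 1 by omega,
      show p + 2 * (m + 1) + 2 = p + 2 * m + 2 + 1 + 1 by omega]
    omega

/-- The same count one level up: the shadow of the first segment, less at most `thinWidth p m - 1`
members of the cutset, still fills the second segment. -/
theorem sum_choose_middle_add_thinWidth (p m : ℕ) :
    p + 2 + ∑ i ∈ range m, (p + 2 + 2 * i).choose (p + 1 + i + 1) + thinWidth p m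
      = p + 2 + ∑ i ∈ range m, (p + 3 + 2 * i).choose (p + 2 + i) + 1 := by
  induction m with
  | zero => simp [thinWidth]
  | succ m ih =>
    rw [sum_range_succ, sum_range_succ, thinWidth_succ,
      Nat.choose_symm_of_eq_add (show p + 3 + 2 * m = (p + 2 + m) + (m + 1) by omega),
      Nat.choose_symm_of_eq_add (show p + 2 + 2 * m = (p + 1 + m + 1) + m by omega)]
    have h1 := Nat.choose_succ_succ' (p + 2 * m + 2) m
    rw [show p + 3 + 2 * m = p + 2 * m + 2 + 1 by omega,
      show p + 2 + 2 * m = p + 2 * m + 2 by omega]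
    omega

/-- By symmetry of binomials the summands agree with those of `thinWidth` after its first, which is
1; the only slack is 1 against `(p + 2).choose p`. -/
theorem thinWidth_le_sum_choose (p m : ℕ) :
    thinWidth p m
      ≤ (p + 2).choose p + ∑ i ∈ range m, (p + 2 + 2 * i).choose (p + 1 + i) := by
  induction m with
  | zero => simpa [thinWidth] using Nat.succ_le_of_lt (Nat.choose_pos (show p ≤ p + 2 by omega))
  | succ m ih =>
    rw [sum_range_succ, thinWidth_succ,
      Nat.choose_symm_of_eq_add (show p + 2 + 2 * m = (p + 1 + m) + (m + 1) by omega),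
      show p + 2 + 2 * m = p + 2 * m + 2 by omega]
    omega

/-- A cutset of three levels has at least `thinWidth p m` members on one of them. -/
theorem IsCutset.thinWidth_le_of_card_slice_le {n p m k : ℕ} (hn : n = p + 2 * m + 2)
    {C : Finset (Finset (Fin n))} (hC : IsCutset n m (m + 2) C)
    (hk : ∀ i, #(C.slice i) ≤ k) : thinWidth p m ≤ k := by
  by_contra! hlt
  -- The last member here is `{0, …, p + 1}` together with `p + 3, p + 5, …, n - 1`. The segment
  -- `hinit₂` starts from all `(p + 1)`-subsets of `{0, …, p + 1}` and adjoins `p + 2, p + 4, …, n -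
  -- 2`.
  obtain ⟨k₁, -, hinit₁⟩ := (hasInitSeg_powersetCard (n := n) 0 (p + 1) (by omega)).extend_iterate
    m (x := p + 3) (by omega) (by omega)
  obtain ⟨k₂, -, hinit₂⟩ := (hasInitSeg_powersetCard (n := n) 1 p (by omega)).extend_iterate
    m (x := p + 2) (by omega) (by omega)
  rw [show 0 + (p + 1) + 1 = p + 2 by omega, show p + 1 + 1 = p + 2 from rfl,
    Nat.choose_self, Nat.choose_succ_self_right]
    at hinit₁
  rw [show 1 + p + 1 = p + 2 by omega, Nat.choose_succ_self_right] at hinit₂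
  have e₁ := sum_choose_add_thinWidth p m
  rw [← hn] at e₁
  have e₂ := sum_choose_middle_add_thinWidth p m
  have e₃ := thinWidth_le_sum_choose p m
  set F : Finset (Finset (Fin n)) := powersetCard m univ \ C with hFdef
  have hF : (F : Set (Finset (Fin n))).Sized m := fun A hA =>
    (mem_powersetCard.1 (mem_sdiff.1 (mem_coe.1 hA)).1).2
  have hF' : n.choose m ≤ #F + k := card_le_card_powersetCard_sdiff (hk m)
  have h1 := hinit₁.le_card_upShadow (by omega) hF (by omega)
  have hG : ((∂⁺ F \ C : Finset (Finset (Fin n))) : Set (Finset (Fin n))).Sized (m + 1) :=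
    fun B hB => hF.upShadow (mem_sdiff.1 (mem_coe.1 hB)).1
  have h2 : #(∂⁺ F) ≤ #(∂⁺ F \ C) + k := by
    have h3 : ∂⁺ F ∩ C ⊆ C.slice (m + 1) := fun B hB =>
      mem_slice.2 ⟨(mem_inter.1 hB).2, hF.upShadow (mem_inter.1 hB).1⟩
    have h4 := card_sdiff_add_card_inter (∂⁺ F) C
    have h5 := card_le_card h3
    have h6 := hk (m + 1)
    omega
  have h3 := hinit₂.le_card_upShadow (by omega) hG (by omega)
  have h4 : ∂⁺ (∂⁺ F \ C) ⊆ C.slice (m + 2) := by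
    intro D hD
    have hDc := hG.upShadow hD
    obtain ⟨B, hB, hBD⟩ := exists_subset_of_mem_upShadow hD
    obtain ⟨A, hA, hAB⟩ := exists_subset_of_mem_upShadow (mem_sdiff.1 hB).1
    refine mem_slice.2 ⟨?_, hDc⟩
    exact ((hC.mem_or_mem_or_mem (hF hA) (hG hB) hDc hAB hBD).resolve_left
      (mem_sdiff.1 hA).2).resolve_left (mem_sdiff.1 hB).2
  have h5 := card_le_card h4
  have h6 := hk (m + 2)
  omega

/-! ### Width, and its relation to `g` and `h` -/

theorem width_le_iff {n w : ℕ} {C : Finset (Finset (Fin n))} :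
    width C ≤ w ↔
      ∀ A ⊆ C, IsAntichain (· ⊆ ·) (A : Set (Finset (Fin n))) → #A ≤ w := by
  refine ⟨fun h A hA hanti => ((width_isGreatest C).2 ⟨A, hA, hanti, rfl⟩).trans h, fun h => ?_⟩
  obtain ⟨A, hA, hanti, hw⟩ := (width_isGreatest C).1
  exact hw ▸ h A hA hanti

theorem width_le_card {n : ℕ} (C : Finset (Finset (Fin n))) : width C ≤ #C :=
  width_le_iff.2 fun _ hA _ => card_le_card hA

theorem width_union_le {n : ℕ} (C D : Finset (Finset (Fin n))) :
    width (C ∪ D) ≤ width C + width D := by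
  refine width_le_iff.2 fun A hA hanti => ?_
  have h1 : #(A ∩ C) ≤ width C := width_le_iff.1 le_rfl _ inter_subset_right
    (hanti.subset (coe_subset.2 inter_subset_left))
  have h2 : #(A ∩ D) ≤ width D := width_le_iff.1 le_rfl _ inter_subset_right
    (hanti.subset (coe_subset.2 inter_subset_left))
  have h3 : A = A ∩ C ∪ A ∩ D := by
    rw [← inter_union_distrib_left, inter_eq_left.2 hA]
  calc #A = #(A ∩ C ∪ A ∩ D) := congrArg card h3
    _ ≤ #(A ∩ C) + #(A ∩ D) := card_union_le _ _
    _ ≤ _ := add_le_add h1 h2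

/-- A family whose members are mapped to `T` with chains as fibres has width at most `#T`. -/
theorem width_le_card_of_fibres {n : ℕ} {ι : Type*} {C : Finset (Finset (Fin n))} (T : Finset ι)
    (f : Finset (Fin n) → ι) (hf : ∀ A ∈ C, f A ∈ T)
    (hchain : ∀ A ∈ C, ∀ B ∈ C, f A = f B → A ⊆ B ∨ B ⊆ A) : width C ≤ #T := by
  refine width_le_iff.2 fun 𝒜 h𝒜 hanti => ?_
  refine card_le_card_of_injOn f (fun A hA => hf A (h𝒜 hA)) fun A hA B hB hAB => ?_
  rcases hchain A (h𝒜 hA) B (h𝒜 hB) hAB with h | h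
  · exact hanti.eq hA hB h
  · exact (hanti.eq hB hA h).symm

/-- Erasing `b` sends antichains of the image injectively to antichains of `C`. -/
theorem width_image_insert_le {n : ℕ} {C : Finset (Finset (Fin n))} {b : Fin n}
    (hb : ∀ A ∈ C, b ∉ A) : width (C.image (insert b)) ≤ width C := by
  refine width_le_iff.2 fun 𝒜 h𝒜 hanti => ?_
  have hmem : ∀ A ∈ 𝒜, b ∈ A ∧ A.erase b ∈ C := by
    intro A hA
    obtain ⟨B, hB, rfl⟩ := mem_image.1 (h𝒜 hA)
    exact ⟨mem_insert_self b B, by rwa [erase_insert (hb B hB)]⟩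
  have hinj : Set.InjOn (fun A : Finset (Fin n) => A.erase b) 𝒜 := by
    intro A hA B hB hAB
    have := congrArg (insert b) hAB
    simpa [insert_erase (hmem A hA).1, insert_erase (hmem B hB).1] using this
  rw [← card_image_of_injOn hinj]
  refine width_le_iff.1 le_rfl _ ?_ ?_
  · intro A hA
    obtain ⟨B, hB, rfl⟩ := mem_image.1 hA
    exact (hmem B hB).2
  · intro A hA B hB hne hAB
    obtain ⟨X, hX, rfl⟩ := mem_image.1 (mem_coe.1 hA)
    obtain ⟨Y, hY, rfl⟩ := mem_image.1 (mem_coe.1 hB)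
    refine hne (congrArg (fun A : Finset (Fin n) => A.erase b) (hanti.eq hX hY ?_))
    have := insert_subset_insert b hAB
    rwa [insert_erase (hmem X hX).1, insert_erase (hmem Y hY).1] at this

theorem card_slice_le_width {n : ℕ} (C : Finset (Finset (Fin n))) (i : ℕ) :
    #(C.slice i) ≤ width C :=
  width_le_iff.1 le_rfl _ slice_subset (sized_slice.isAntichain)

theorem g_le_h (n m l : ℕ) : g n m l ≤ h n m l := by
  obtain ⟨C, hC, hw⟩ := (h_isLeast n m l).1
  exact (g_isLeast n m l).2 ⟨C, hC, fun i => hw ▸ card_slice_le_width C i⟩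

/-- Matching bounds for `g` and `h` determine both. -/
theorem h_eq_and_g_eq_h {n m l w : ℕ} {C : Finset (Finset (Fin n))} (hC : IsCutset n m l C)
    (hw : width C ≤ w)
    (hlow : ∀ D k, IsCutset n m l D → (∀ i, #(D.slice i) ≤ k) → w ≤ k) :
    h n m l = w ∧ g n m l = h n m l := by
  have h1 : h n m l ≤ w := ((h_isLeast n m l).2 ⟨C, hC, rfl⟩).trans hw
  obtain ⟨D, hD, hk⟩ := (g_isLeast n m l).1
  have h2 := hlow D _ hD hk
  have h3 := g_le_h n m l
  omega

/-- Cardinality is injective on a chain, and `D` has as many members as there are levels. -/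
theorem IsMaximalChain.exists_card_eq {n m l : ℕ} {D : Finset (Finset (Fin n))}
    (hD : IsMaximalChain n m l D) (hml : m ≤ l) {i : ℕ} (hmi : m ≤ i) (hil : i ≤ l) :
    ∃ A ∈ D, #A = i := by
  obtain ⟨hsub, hchain, hcard⟩ := hD
  have hinj : Set.InjOn card (D : Set (Finset (Fin n))) := by
    intro A hA B hB hAB
    rcases hchain.total hA hB with h | h
    · exact eq_of_subset_of_card_le h hAB.ge
    · exact (eq_of_subset_of_card_le h hAB.le).symm
  have himg : D.image card = Icc m l := by
    refine eq_of_subset_of_card_le ?_ ?_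
    · intro j hj
      obtain ⟨A, hA, rfl⟩ := mem_image.1 hj
      exact mem_Icc.2 (mem_filter.1 (hsub hA)).2
    · rw [card_image_of_injOn hinj, hcard, Nat.card_Icc]
      omega
  exact mem_image.1 (himg ▸ mem_Icc.2 ⟨hmi, hil⟩)

theorem IsMaximalChain.subset_of_card_lt {n m l : ℕ} {D : Finset (Finset (Fin n))}
    (hD : IsMaximalChain n m l D) {A B : Finset (Fin n)} (hA : A ∈ D) (hB : B ∈ D)
    (hAB : #A < #B) : A ⊆ B :=
  (hD.2.1.total hA hB).resolve_right fun h => hAB.not_ge (card_le_card h)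

/-! ### Thin cutsets and the values of `g` and `h` -/

/-- On one level the only cutset is the whole level. -/
theorem h_eq_and_g_eq_h_one_level (n m : ℕ) :
    h n m m = n.choose m ∧ g n m m = h n m m := by
  refine h_eq_and_g_eq_h (isCutset_lattice n m m) ?_ fun D k hD hk => ?_
  · refine (width_le_card _).trans (le_of_eq ?_)
    rw [show lattice n m m = powersetCard m univ by
      ext A
      simp [lattice, mem_powersetCard, le_antisymm_iff, and_comm]]
    simp
  · have hsub : powersetCard m univ ⊆ D.slice m := by
      intro A hA
      have hAm := (mem_powersetCard.1 hA).2
      obtain ⟨B, hB, hBD⟩ := hD.2 {A} ⟨by simp [lattice, hAm], by simp, by simp⟩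
      rw [mem_singleton] at hB
      exact mem_slice.2 ⟨hB ▸ hBD, hAm⟩
    have := (card_le_card hsub).trans (hk m)
    simpa using this

theorem h_eq_and_g_eq_h_two_levels (m d : ℕ) :
    h (m + d + 1) m (m + 1) = (m + d).choose m ∧
      g (m + d + 1) m (m + 1) = h (m + d + 1) m (m + 1) := by
  set a : Fin (m + d + 1) := Fin.last (m + d)
  refine h_eq_and_g_eq_h (C := univ.filter fun A : Finset (Fin (m + d + 1)) =>
    (a ∉ A ∧ #A = m) ∨ (a ∈ A ∧ #A = m + 1)) ⟨?_, fun D hD => ?_⟩ ?_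
    fun D k hD hk => hD.choose_le_of_card_slice_le hk
  · intro A hA
    simp only [lattice, mem_filter, mem_univ, true_and] at hA ⊢
    omega
  · obtain ⟨A, hA, hAm⟩ := hD.exists_card_eq (by omega) le_rfl (Nat.le_succ m)
    obtain ⟨B, hB, hBm⟩ := hD.exists_card_eq (by omega) (Nat.le_succ m) le_rfl
    have hAB := hD.subset_of_card_lt hA hB (by omega)
    by_cases ha : a ∈ A
    · exact ⟨B, hB, by simp [hAB ha, hBm]⟩
    · exact ⟨A, hA, by simp [ha, hAm]⟩
  · have hcard : #(powersetCard m (univ.erase a)) = (m + d).choose m := by simp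
    rw [← hcard]
    -- The fibres are the pairs `A ⊂ A ∪ {a}`, one for each `m`-set avoiding `a`.
    refine width_le_card_of_fibres _ (fun A => A.erase a) (fun A hA => ?_)
      fun A hA B hB hAB => ?_
    · rw [mem_powersetCard]
      refine ⟨erase_subset_erase _ (subset_univ A), ?_⟩
      rcases (mem_filter.1 hA).2 with ⟨ha, hc⟩ | ⟨ha, hc⟩
      · rwa [erase_eq_of_notMem ha]
      · rw [card_erase_of_mem ha, hc, Nat.add_sub_cancel]
    · by_cases ha : a ∈ A
      · right
        calc B ⊆ insert a (B.erase a) := subset_insert_iff.2 (Subset.refl _)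
          _ = A := by rw [← hAB, insert_erase ha]
      · left
        calc A = B.erase a := by rw [← hAB, erase_eq_of_notMem ha]
          _ ⊆ B := erase_subset _ _

/-- A thin cutset of three levels of the subsets of `s`, built by removing two elements `a`, `b`
from `s`: the subsets that avoid both, contain only `a` or contain both are handled by
symmetric chains, those that contain only `b` by recursion. -/
theorem exists_thin_cutset {n p m : ℕ} (s : Finset (Fin n)) (hs : #s = p + 2 * m + 2) :
    ∃ C : Finset (Finset (Fin n)), (∀ A ∈ C, A ⊆ s ∧ m ≤ #A ∧ #A ≤ m + 2) ∧
      (∀ A B D, A ⊆ B → B ⊆ D → D ⊆ s → #A = m → #B = m + 1 → #D = m + 2 →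
        A ∈ C ∨ B ∈ C ∨ D ∈ C) ∧ width C ≤ thinWidth p m := by
  induction m generalizing s with
  | zero =>
    refine ⟨{∅}, by simp, fun A B D _ _ _ hA _ _ => ?_, ?_⟩
    · simp [card_eq_zero.1 hA]
    · exact (width_le_card _).trans (by simp [thinWidth])
  | succ m ih =>
    obtain ⟨a, ha⟩ : s.Nonempty := card_pos.1 (by omega)
    have hsa : #(s.erase a) = p + 2 * m + 3 := by rw [card_erase_of_mem ha]; omega
    obtain ⟨b, hb⟩ : (s.erase a).Nonempty := card_pos.1 (by omega)
    have hsb : #((s.erase a).erase b) = p + 2 * m + 2 := by rw [card_erase_of_mem hb]; omega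
    have hba : b ≠ a := ne_of_mem_erase hb
    have hbs : b ∈ s := mem_of_mem_erase hb
    set s' := (s.erase a).erase b with hs'
    obtain ⟨C, hC, hcut, hw⟩ := ih s' hsb
    have has' : a ∉ s' := by simp [hs']
    have hbs' : b ∉ s' := by simp [hs']
    have hbC : ∀ A ∈ C, b ∉ A := fun A hA h => hbs' ((hC A hA).1 h)
    set K : Finset (Finset (Fin n)) := s.powerset.filter fun A =>
      (a ∉ A ∧ b ∉ A ∧ #A = m + 1) ∨ (a ∈ A ∧ b ∉ A ∧ #A = m + 2) ∨
        (a ∈ A ∧ b ∈ A ∧ #A = m + 3) with hK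
    have hKw : width K ≤ (p + 2 * m + 2).choose (m + 1) := by
      rw [← hsb, ← card_powersetCard]
      refine width_le_card_of_fibres _ (fun A => (A.erase a).erase b) (fun A hA => ?_)
        fun A hA B hB hAB => ?_
      · rw [hK, mem_filter, mem_powerset] at hA
        rw [mem_powersetCard]
        refine ⟨erase_subset_erase _ (erase_subset_erase _ hA.1), ?_⟩
        rcases hA.2 with ⟨h1, h2, h3⟩ | ⟨h1, h2, h3⟩ | ⟨h1, h2, h3⟩
        · rw [erase_eq_of_notMem h1, erase_eq_of_notMem h2, h3]
        · rw [erase_eq_of_notMem (fun h => h2 (mem_of_mem_erase h)), card_erase_of_mem h1, h3]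
          rfl
        · rw [card_erase_of_mem (mem_erase.2 ⟨hba, h2⟩), card_erase_of_mem h1, h3]
          rfl
      · have key : ∀ A B : Finset (Fin n), (A.erase a).erase b = (B.erase a).erase b →
            (a ∈ A → a ∈ B) → (b ∈ A → b ∈ B) → A ⊆ B := by
          intro A B hAB h1 h2 x hx
          by_cases hxa : x = a
          · exact hxa ▸ h1 (hxa ▸ hx)
          by_cases hxb : x = b
          · exact hxb ▸ h2 (hxb ▸ hx)
          have : x ∈ (B.erase a).erase b := hAB ▸ by simp [hxa, hxb, hx]
          exact mem_of_mem_erase (mem_of_mem_erase this)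
        have hA' := (mem_filter.1 hA).2
        have hB' := (mem_filter.1 hB).2
        -- The traces on `{a, b}` allowed in `K` are `∅`, `{a}`, `{a, b}`, which form a chain.
        have hor : ((a ∈ A → a ∈ B) ∧ (b ∈ A → b ∈ B)) ∨ ((a ∈ B → a ∈ A) ∧ (b ∈ B → b ∈ A)) := by
          tauto
        exact hor.imp (fun h => key A B hAB h.1 h.2) fun h => key B A hAB.symm h.1 h.2
    refine ⟨K ∪ C.image (insert b), ?_, ?_, ?_⟩
    · intro A hA
      rcases mem_union.1 hA with hA | hA
      · rw [hK, mem_filter, mem_powerset] at hA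
        exact ⟨hA.1, by omega, by omega⟩
      · obtain ⟨B, hB, rfl⟩ := mem_image.1 hA
        obtain ⟨h1, h2, h3⟩ := hC B hB
        rw [card_insert_of_notMem (hbC B hB)]
        exact ⟨insert_subset hbs (h1.trans ((erase_subset _ _).trans (erase_subset _ _))),
          by omega, by omega⟩
    · intro A B D hAB hBD hDs hAm hBm hDm
      have hmemK : ∀ X, X ∈ K ↔ X ⊆ s ∧ ((a ∉ X ∧ b ∉ X ∧ #X = m + 1) ∨
          (a ∈ X ∧ b ∉ X ∧ #X = m + 2) ∨ (a ∈ X ∧ b ∈ X ∧ #X = m + 3)) := by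
        intro X
        rw [hK, mem_filter, mem_powerset]
      simp only [mem_union, hmemK]
      by_cases haD : a ∈ D
      · by_cases hbD : b ∈ D
        · exact Or.inr (Or.inr (Or.inl ⟨hDs, Or.inr (Or.inr ⟨haD, hbD, hDm⟩)⟩))
        · have hbB : b ∉ B := fun h => hbD (hBD h)
          by_cases haB : a ∈ B
          · exact Or.inr (Or.inl (Or.inl ⟨hBD.trans hDs, Or.inr (Or.inl ⟨haB, hbB, hBm⟩)⟩))
          · exact Or.inl (Or.inl ⟨hAB.trans (hBD.trans hDs),
              Or.inl ⟨fun h => haB (hAB h), fun h => hbB (hAB h), hAm⟩⟩)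
      · have haA : a ∉ A := fun h => haD (hBD (hAB h))
        by_cases hbA : b ∈ A
        · have hbB := hAB hbA
          have hbD := hBD hbB
          have := hcut (A.erase b) (B.erase b) (D.erase b) (erase_subset_erase b hAB)
            (erase_subset_erase b hBD)
            (erase_subset_erase b fun x hx => mem_erase.2 ⟨fun h => haD (h ▸ hx), hDs hx⟩)
            (by rw [card_erase_of_mem hbA]; omega) (by rw [card_erase_of_mem hbB]; omega)
            (by rw [card_erase_of_mem hbD]; omega)
          rcases this with h | h | h
          · exact Or.inl (Or.inr (mem_image.2 ⟨_, h, insert_erase hbA⟩))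
          · exact Or.inr (Or.inl (Or.inr (mem_image.2 ⟨_, h, insert_erase hbB⟩)))
          · exact Or.inr (Or.inr (Or.inr (mem_image.2 ⟨_, h, insert_erase hbD⟩)))
        · exact Or.inl (Or.inl ⟨hAB.trans (hBD.trans hDs), Or.inl ⟨haA, hbA, hAm⟩⟩)
    · rw [thinWidth_succ, add_comm (thinWidth p m)]
      exact (width_union_le _ _).trans (add_le_add hKw ((width_image_insert_le hbC).trans hw))

theorem h_eq_and_g_eq_h_three_levels {n m p : ℕ} (hn : n = p + 2 * m + 2) :
    h n m (m + 2) = thinWidth p m ∧ g n m (m + 2) = h n m (m + 2) := by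
  obtain ⟨C, hC, hcut, hw⟩ := exists_thin_cutset (p := p) (m := m) (univ : Finset (Fin n))
    (by simpa using hn)
  refine h_eq_and_g_eq_h (C := C) ⟨fun A hA => ?_, fun D hD => ?_⟩ hw
    fun D k hD hk => hD.thinWidth_le_of_card_slice_le hn hk
  · exact mem_filter.2 ⟨mem_univ A, (hC A hA).2⟩
  · obtain ⟨X, hX, hXm⟩ := hD.exists_card_eq (by omega) le_rfl (by omega)
    obtain ⟨Y, hY, hYm⟩ := hD.exists_card_eq (i := m + 1) (by omega) (by omega) (by omega)
    obtain ⟨Z, hZ, hZm⟩ := hD.exists_card_eq (i := m + 2) (by omega) (by omega) le_rfl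
    rcases hcut X Y Z (hD.subset_of_card_lt hX hY (by omega))
      (hD.subset_of_card_lt hY hZ (by omega)) (subset_univ Z) hXm hYm hZm with h | h | h
    · exact ⟨X, hX, h⟩
    · exact ⟨Y, hY, h⟩
    · exact ⟨Z, hZ, h⟩

/-! ### Closed forms and telescoping of the sums of `delta` -/

theorem sum_choose_eq_thinWidth {n m p : ℕ} (hn : n = p + 2 * m + 2) :
    ∑ j ∈ range (m + 1), (n - 2 * j - 2).choose (m - j) = thinWidth p m := by
  rw [thinWidth, ← sum_range_reflect]
  refine sum_congr rfl fun j hj => ?_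
  rw [mem_range] at hj
  congr 1 <;> omega

theorem binom_natCast (n k : ℕ) : binom n k = n.choose k := by
  simp [binom]

theorem binom_of_neg (n : ℕ) {k : ℤ} (hk : k < 0) : binom n k = 0 :=
  if_neg hk.not_ge

theorem binom_succ (n : ℕ) (k : ℤ) : binom (n + 1) k = binom n k + binom n (k - 1) := by
  rcases lt_trichotomy k 0 with hk | rfl | hk
  · rw [binom_of_neg _ hk, binom_of_neg _ hk, binom_of_neg _ (by omega), add_zero]
  · rw [binom_of_neg n (show (0 : ℤ) - 1 < 0 by norm_num)]
    simp [binom]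
  · obtain ⟨j, rfl⟩ : ∃ j : ℕ, k = (j + 1 : ℕ) := ⟨k.toNat - 1, by omega⟩
    rw [show ((j + 1 : ℕ) : ℤ) - 1 = (j : ℕ) by push_cast; ring, binom_natCast, binom_natCast,
      binom_natCast, Nat.choose_succ_succ']
    push_cast
    ring

theorem deltaSum_one (n m : ℕ) : deltaSum n m 1 = n.choose m := by
  have : ∀ j : ℕ, delta n ((m : ℤ) - j * (1 : ℕ))
      = binom n ((m : ℤ) - j) - binom n ((m : ℤ) - (j + 1 : ℕ)) := by
    intro j
    rw [delta]
    push_cast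
    ring_nf
  rw [deltaSum, sum_congr rfl fun j _ => this j,
    sum_range_sub' (fun j : ℕ => binom n ((m : ℤ) - j)),
    binom_of_neg n (show (m : ℤ) - (m + 1 : ℕ) < 0 by push_cast; omega)]
  simp [binom_natCast]

/-- Pascal's rule gives `Δ_{n+1}(k) = C(n,k) - C(n,k-2)`, which telescopes in steps of 2. -/
theorem deltaSum_two (n m : ℕ) : deltaSum (n + 1) m 2 = n.choose m := by
  have : ∀ j : ℕ, delta (n + 1) ((m : ℤ) - j * (2 : ℕ))
      = binom n ((m : ℤ) - j * 2) - binom n ((m : ℤ) - (j + 1 : ℕ) * 2) := by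
    intro j
    rw [delta, binom_succ, binom_succ]
    push_cast
    ring_nf
  rw [deltaSum, sum_congr rfl fun j _ => this j,
    sum_range_sub' (fun j : ℕ => binom n ((m : ℤ) - j * 2)),
    binom_of_neg n (show (m : ℤ) - (m + 1 : ℕ) * 2 < 0 by push_cast; omega)]
  simp [binom_natCast]

/-- Pascal's rule twice gives `Δ_{n+2}(k+1) - Δ_n(k) = C(n,k+1) - C(n,k-2)`, which telescopes in
steps of 3. This matches the recursion `thinWidth_succ`. -/
theorem deltaSum_three_succ (n m : ℕ) :
    deltaSum (n + 2) (m + 1) 3 = deltaSum n m 3 + n.choose (m + 1) := by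
  -- The added term `j = m + 1` vanishes and makes both sums equally long.
  have hext : deltaSum n m 3
      = ∑ j ∈ range (m + 1 + 1), delta n ((m : ℤ) - j * (3 : ℕ)) := by
    rw [sum_range_succ, delta, binom_of_neg n (by push_cast; omega),
      binom_of_neg n (by push_cast; omega), deltaSum]
    ring
  have : ∀ j : ℕ, delta (n + 2) (((m + 1 : ℕ) : ℤ) - j * (3 : ℕ))
      - delta n ((m : ℤ) - j * (3 : ℕ))
      = binom n (((m + 1 : ℕ) : ℤ) - j * 3) - binom n (((m + 1 : ℕ) : ℤ) - (j + 1 : ℕ) * 3) := by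
    intro j
    simp only [delta, binom_succ (n + 1), binom_succ n]
    push_cast
    ring_nf
  rw [← sub_eq_iff_eq_add', hext, deltaSum, ← sum_sub_distrib,
    sum_congr rfl fun j _ => this j,
    sum_range_sub' (fun j : ℕ => binom n (((m + 1 : ℕ) : ℤ) - j * 3)),
    binom_of_neg n (show ((m + 1 : ℕ) : ℤ) - (m + 1 + 1 : ℕ) * 3 < 0 by push_cast; omega)]
  simp only [Nat.cast_zero, zero_mul, sub_zero, binom_natCast]

theorem deltaSum_three (p m : ℕ) : deltaSum (p + 2 * m + 2) m 3 = thinWidth p m := by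
  induction m with
  | zero => simp [deltaSum, delta, binom, thinWidth]
  | succ m ih =>
    rw [thinWidth_succ, show p + 2 * (m + 1) + 2 = p + 2 * m + 2 + 2 by ring,
      deltaSum_three_succ, ih]
    push_cast
    ring

end TruncatedBoolean

theorem theorem2 (m n : ℕ) :
    (m ≤ n →
      (TruncatedBoolean.h n m m : ℤ) = TruncatedBoolean.deltaSum n m 1 ∧
      TruncatedBoolean.h n m m = n.choose m ∧
      TruncatedBoolean.g n m m = TruncatedBoolean.h n m m) ∧
    (m + 1 ≤ n →
      (TruncatedBoolean.h n m (m + 1) : ℤ) = TruncatedBoolean.deltaSum n m 2 ∧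
      TruncatedBoolean.h n m (m + 1) = (n - 1).choose m ∧
      TruncatedBoolean.g n m (m + 1) = TruncatedBoolean.h n m (m + 1)) ∧
    (2 * m + 2 ≤ n →
      (TruncatedBoolean.h n m (m + 2) : ℤ) = TruncatedBoolean.deltaSum n m 3 ∧
      TruncatedBoolean.h n m (m + 2) =
        ∑ j ∈ Finset.range (m + 1), (n - 2 * j - 2).choose (m - j) ∧
      TruncatedBoolean.g n m (m + 2) = TruncatedBoolean.h n m (m + 2)) := by
  refine ⟨fun hn => ?_, fun hn => ?_, fun hn => ?_⟩
  · obtain ⟨hh, hg⟩ := TruncatedBoolean.h_eq_and_g_eq_h_one_level n m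
    exact ⟨by rw [hh, TruncatedBoolean.deltaSum_one], hh, hg⟩
  · obtain ⟨d, rfl⟩ : ∃ d, n = m + d + 1 := ⟨n - (m + 1), by omega⟩
    obtain ⟨hh, hg⟩ := TruncatedBoolean.h_eq_and_g_eq_h_two_levels m d
    exact ⟨by rw [hh, TruncatedBoolean.deltaSum_two], hh, hg⟩
  · obtain ⟨p, rfl⟩ : ∃ p, n = p + 2 * m + 2 := ⟨n - (2 * m + 2), by omega⟩
    obtain ⟨hh, hg⟩ := TruncatedBoolean.h_eq_and_g_eq_h_three_levels (n := p + 2 * m + 2) rfl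
    exact ⟨by rw [hh, TruncatedBoolean.deltaSum_three],
      hh.trans (TruncatedBoolean.sum_choose_eq_thinWidth rfl).symm, hg⟩
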